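/- Let $A>1$ and $q>0$. There is a constant $c>0$, depending only on $A$ and $q$, such that for every dimension $d\ge 1$, every integer $M\ge 2$ and every integer $n$ with $\log M\le 16(\min(1,A-1))^2 n$, $$\sup_{f_1,\dots,f_M\in\mathcal F_H(A)}\ \inf_{\hat f_n}\ \sup_{f\in\mathcal F(A)}\Big[\mathbb E_f\big[H(\hat f_n,f)^q\big]-\min_{j=1,\dots,M}H(f_j,f)^q\Big]\ \ge\ c\Big(\frac{\log M}{n}\Big)^{q/2}.$$ Here $\mathcal F_H(A)$ is the set of non-negative measurable functions on $\mathbb R^d$ bounded by $A$; $\mathcal F(A)$ is the set of probability densities on $\mathbb R^d$ with respect to Lebesgue measure that are bounded by $A$; $H(f,g)=\big(\int_{\mathbb R^d}(\sqrt{f(x)}-\sqrt{g(x)})^2\,dx\big)^{1/2}\in[0,\infty]$ is the Hellinger distance; the infimum is over all estimators $\hat f_n$ based on a sample of size $n$, i.e. all non-negative jointly measurable functions $\hat f_n(X_1,\dots,X_n;x)$; and $\mathbb E_f$ is the expectation when $X_1,\dots,X_n$ are i.i.d. with density $f$. The bracket takes values in $[-\infty,\infty]$, with $\infty-\infty:=-\infty$.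 -/

import Mathlib

open MeasureTheory
open scoped ENNReal

namespace Aggregation

/-- The Hellinger distance `‖√f - √g‖_{L²(ν)}` between non-negative measurable functions,
with values in `[0, ∞]`. -/
noncomputable def hellinger {X : Type*} [MeasurableSpace X] (ν : Measure X) (f g : X → ℝ) :
    ℝ≥0∞ :=
  eLpNorm (fun x => √(f x) - √(g x)) 2 ν

/-- Non-negative measurable functions bounded by `A`. -/
def boundedNonneg (X : Type*) [MeasurableSpace X] (A : ℝ) : Set (X → ℝ) :=
  {f | Measurable f ∧ (∀ x, 0 ≤ f x) ∧ ∀ x, f x ≤ A}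

/-- Probability densities with respect to `ν` bounded by `A`. -/
def boundedDensities {X : Type*} [MeasurableSpace X] (ν : Measure X) (A : ℝ) : Set (X → ℝ) :=
  {f | f ∈ boundedNonneg X A ∧ ∫⁻ x, ENNReal.ofReal (f x) ∂ν = 1}

/-- The law of an i.i.d. sample of size `n` with density `f` with respect to `ν`. -/
noncomputable def sampleLaw {X : Type*} [MeasurableSpace X] (ν : Measure X) (f : X → ℝ)
    (n : ℕ) : Measure (Fin n → X) :=
  Measure.pi fun _ => ν.withDensity fun x => ENNReal.ofReal (f x)

/-- Estimators based on a sample of size `n`: jointly measurable maps sending a sample and a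
point to the value at that point of the estimate, a non-negative function. -/
def estimators (X : Type*) [MeasurableSpace X] (n : ℕ) : Set ((Fin n → X) → X → ℝ) :=
  {T | Measurable (Function.uncurry T) ∧ ∀ s x, 0 ≤ T s x}

/-- The risk `𝔼_f [H(T, f) ^ q]`, with values in `[0, ∞]`. -/
noncomputable def hellingerRisk {X : Type*} [MeasurableSpace X] (ν : Measure X) (q : ℝ) {n : ℕ}
    (T : (Fin n → X) → X → ℝ) (f : X → ℝ) : ℝ≥0∞ :=
  ∫⁻ s, hellinger ν (T s) f ^ q ∂(sampleLaw ν f n)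

/-- The excess risk `𝔼_f [H(T, f) ^ q] - min_j H(g_j, f) ^ q` as an extended real number.
With the conventions of `EReal`, `∞ - ∞ = -∞`, the choice that makes lower bounds hardest. -/
noncomputable def excessHellingerRisk {X : Type*} [MeasurableSpace X] (ν : Measure X) (q : ℝ)
    {n M : ℕ} (g : Fin M → X → ℝ) (T : (Fin n → X) → X → ℝ) (f : X → ℝ) : EReal :=
  (hellingerRisk ν q T f : EReal) - ((⨅ j, hellinger ν (g j) f ^ q : ℝ≥0∞) : EReal)

end Aggregation

/-!
Perturb the uniform density on the unit cube to `1 + ε cos (2πj x₁)` for `1 ≤ j ≤ M`, with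
`ε² = log M / (16 n)`. Any two of these densities are at `L²` distance exactly `ε`, and the `L²`
distance of bounded densities is at most a constant times their Hellinger distance. The likelihood
of `n` observations relative to the uniform law has second moment
`(1 + ε² / 2) ^ n ≤ M ^ (1 / 32) ≤ (3 / 4)² M`, so by the Cauchy–Schwarz inequality `M` disjoint
events cannot all have probability larger than `3 / 4` under their respective densities. Hence every
estimator is at Hellinger distance at least a multiple of `ε` from one of the densities with
probability at least `1 / 4`. Taking these densities as `f₁, …, f_M`, the subtracted minimum
vanishes at each of them, and the risk bound is a bound on the excess risk.
-/

namespace Aggregation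

section PiWithDensity

theorem lintegral_fin_nat_prod_eq_prod {n : ℕ} {X : Fin n → Type*} [∀ i, MeasurableSpace (X i)]
    {μ : ∀ i, Measure (X i)} [∀ i, SigmaFinite (μ i)] {f : ∀ i, X i → ℝ≥0∞}
    (hf : ∀ i, Measurable (f i)) :
    ∫⁻ x, ∏ i, f i (x i) ∂Measure.pi μ = ∏ i, ∫⁻ x, f i x ∂μ i := by
  induction n with
  | zero => simp
  | succ n ih =>
    have hmeas : Measurable fun x : ∀ i, X i => ∏ i, f i (x i) :=
      Finset.measurable_fun_prod _ fun i _ => (hf i).comp (measurable_pi_apply i)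
    have htail : Measurable fun y : ∀ i : Fin n, X (Fin.succAbove 0 i) =>
        ∏ i, f (Fin.succAbove 0 i) (y i) :=
      Finset.measurable_fun_prod _ fun i _ => (hf _).comp (measurable_pi_apply i)
    rw [← (measurePreserving_piFinSuccAbove μ 0).symm.lintegral_comp hmeas]
    simp only [Fin.prod_univ_succAbove _ 0, MeasurableEquiv.piFinSuccAbove_symm_apply,
      Fin.insertNthEquiv_apply, Fin.insertNth_apply_same, Fin.insertNth_apply_succAbove]
    rw [lintegral_prod_mul (hf 0).aemeasurable htail.aemeasurable, ih fun i => hf _]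

theorem pi_withDensity {n : ℕ} {X : Fin n → Type*} [∀ i, MeasurableSpace (X i)]
    {μ : ∀ i, Measure (X i)} [∀ i, SigmaFinite (μ i)] {f : ∀ i, X i → ℝ≥0∞}
    [∀ i, SigmaFinite ((μ i).withDensity (f i))] (hf : ∀ i, Measurable (f i)) :
    Measure.pi (fun i => (μ i).withDensity (f i)) =
      (Measure.pi μ).withDensity fun x => ∏ i, f i (x i) := by
  refine Measure.pi_eq fun t ht => ?_
  rw [withDensity_apply _ (MeasurableSet.univ_pi ht), Measure.restrict_pi_pi,
    lintegral_fin_nat_prod_eq_prod hf]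
  exact Finset.prod_congr rfl fun i _ => (withDensity_apply _ (ht i)).symm

end PiWithDensity

section Testing

variable {Ω : Type*} [MeasurableSpace Ω] {P : Measure Ω} [IsProbabilityMeasure P]

theorem sq_lintegral_le_lintegral_sq {f : Ω → ℝ≥0∞} (hf : Measurable f) :
    (∫⁻ ω, f ω ∂P) ^ 2 ≤ ∫⁻ ω, f ω ^ 2 ∂P := by
  have h := ENNReal.lintegral_mul_le_Lp_mul_Lq P Real.HolderConjugate.two_two hf.aemeasurable
    (g := 1) aemeasurable_const
  rw [← ENNReal.rpow_le_rpow_iff (z := 1 / 2) (by norm_num), ← ENNReal.rpow_natCast_mul]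
  simpa using h

variable {ι : Type*} [Fintype ι] {L : ι → Ω → ℝ≥0∞} {B : ι → Set Ω}

theorem sq_sum_withDensity_le_sum_lintegral_sq (hL : ∀ j, Measurable (L j))
    (hB : ∀ j, MeasurableSet (B j)) (hdisj : Pairwise fun i j => Disjoint (B i) (B j)) :
    (∑ j, P.withDensity (L j) (B j)) ^ 2 ≤ ∑ j, ∫⁻ ω, L j ω ^ 2 ∂P := by
  have pointwise (ω : Ω) : (∑ j, (B j).indicator (L j) ω) ^ 2 ≤ ∑ j, L j ω ^ 2 := by
    by_cases h : ∃ i, ω ∈ B i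
    · obtain ⟨i, hi⟩ := h
      have hne (j : ι) (hj : j ≠ i) : ω ∉ B j := Set.disjoint_right.1 (hdisj hj) hi
      rw [Fintype.sum_eq_single i fun j hj => Set.indicator_of_notMem (hne j hj) _,
        Set.indicator_of_mem hi]
      exact Finset.single_le_sum_of_canonicallyOrdered (f := fun j => L j ω ^ 2)
        (Finset.mem_univ i)
    · push Not at h
      simp [Set.indicator_of_notMem (h _)]
  calc (∑ j, P.withDensity (L j) (B j)) ^ 2
      = (∫⁻ ω, ∑ j, (B j).indicator (L j) ω ∂P) ^ 2 := by
        rw [lintegral_finsetSum _ fun j _ => (hL j).indicator (hB j)]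
        simp_rw [lintegral_indicator (hB _), withDensity_apply _ (hB _)]
    _ ≤ ∫⁻ ω, (∑ j, (B j).indicator (L j) ω) ^ 2 ∂P :=
        sq_lintegral_le_lintegral_sq
          (Finset.measurable_fun_sum _ fun j _ => (hL j).indicator (hB j))
    _ ≤ ∫⁻ ω, ∑ j, L j ω ^ 2 ∂P := lintegral_mono pointwise
    _ = ∑ j, ∫⁻ ω, L j ω ^ 2 ∂P := lintegral_finsetSum _ fun j _ => (hL j).pow_const 2

theorem exists_withDensity_le_of_lintegral_sq_le [Nonempty ι] (hL : ∀ j, Measurable (L j))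
    (hB : ∀ j, MeasurableSet (B j)) (hdisj : Pairwise fun i j => Disjoint (B i) (B j))
    {p : ℝ≥0∞} (hp : ∀ j, ∫⁻ ω, L j ω ^ 2 ∂P ≤ p ^ 2 * Fintype.card ι) :
    ∃ j, P.withDensity (L j) (B j) ≤ p := by
  have hsq : (∑ j, P.withDensity (L j) (B j)) ^ 2 ≤ (∑ _ : ι, p) ^ 2 :=
    calc (∑ j, P.withDensity (L j) (B j)) ^ 2
        ≤ ∑ j, ∫⁻ ω, L j ω ^ 2 ∂P := sq_sum_withDensity_le_sum_lintegral_sq hL hB hdisj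
      _ ≤ ∑ _ : ι, p ^ 2 * Fintype.card ι := Finset.sum_le_sum fun j _ => hp j
      _ = (∑ _ : ι, p) ^ 2 := by
        simp only [Finset.sum_const, Finset.card_univ, nsmul_eq_mul]
        ring
  obtain ⟨j, -, hj⟩ := ENNReal.exists_le_of_sum_le Finset.univ_nonempty
    ((ENNReal.pow_le_pow_left_iff two_ne_zero).1 hsq)
  exact ⟨j, hj⟩

end Testing

section Hellinger

variable {X : Type*} [MeasurableSpace X] {μ : Measure X} {f g h : X → ℝ}

theorem hellinger_self : hellinger μ f f = 0 := by
  simp [hellinger]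

theorem hellinger_comm : hellinger μ f g = hellinger μ g f :=
  eLpNorm_sub_comm _ _ _ _

theorem hellinger_triangle (hf : Measurable f) (hg : Measurable g) (hh : Measurable h) :
    hellinger μ f h ≤ hellinger μ f g + hellinger μ g h := by
  have hsplit : (fun x => √(f x) - √(h x)) =
      (fun x => √(f x) - √(g x)) + fun x => √(g x) - √(h x) := by
    ext x
    simp
  rw [hellinger, hsplit]
  exact eLpNorm_add_le (hf.sqrt.sub hg.sqrt).aestronglyMeasurable
    (hg.sqrt.sub hh.sqrt).aestronglyMeasurable one_le_two

theorem measurable_hellinger_left [SFinite μ] {S : Type*} [MeasurableSpace S] {T : S → X → ℝ}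
    (hT : Measurable (Function.uncurry T)) (hf : Measurable f) :
    Measurable fun s => hellinger μ (T s) f := by
  simp only [hellinger, eLpNorm_eq_lintegral_rpow_enorm_toReal two_ne_zero ENNReal.ofNat_ne_top]
  have hT' : Measurable fun p : S × X => T p.1 p.2 := hT
  have hdiff : Measurable fun p : S × X => √(T p.1 p.2) - √(f p.2) :=
    hT'.sqrt.sub (hf.comp measurable_snd).sqrt
  exact (hdiff.enorm.pow_const _).lintegral_prod_right'.pow_const _

theorem abs_sub_le_two_mul_sqrt_mul_abs_sqrt_sub_sqrt {a b A : ℝ} (ha : 0 ≤ a) (hb : 0 ≤ b)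
    (haA : a ≤ A) (hbA : b ≤ A) : |a - b| ≤ 2 * √A * |√a - √b| := by
  have hfactor : a - b = (√a + √b) * (√a - √b) := by
    rw [← sq_sub_sq, Real.sq_sqrt ha, Real.sq_sqrt hb]
  rw [hfactor, abs_mul, abs_of_nonneg (by positivity), two_mul]
  gcongr

theorem eLpNorm_sub_le_mul_hellinger {A : ℝ} (hf : f ∈ boundedNonneg X A)
    (hg : g ∈ boundedNonneg X A) :
    eLpNorm (fun x => f x - g x) 2 μ ≤ ENNReal.ofReal (2 * √A) * hellinger μ f g :=
  eLpNorm_le_mul_eLpNorm_of_ae_le_mul (.of_forall fun x =>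
    abs_sub_le_two_mul_sqrt_mul_abs_sqrt_sub_sqrt (hf.2.1 x) (hg.2.1 x) (hf.2.2 x) (hg.2.2 x)) 2

end Hellinger

section MinimaxRisk

variable {X : Type*} [MeasurableSpace X] {μ : Measure X} {n : ℕ} {q : ℝ}

theorem isProbabilityMeasure_sampleLaw {f : X → ℝ}
    (hf : ∫⁻ x, ENNReal.ofReal (f x) ∂μ = 1) : IsProbabilityMeasure (sampleLaw μ f n) := by
  have : IsProbabilityMeasure (μ.withDensity fun x => ENNReal.ofReal (f x)) :=
    ⟨by rw [withDensity_apply _ .univ, Measure.restrict_univ, hf]⟩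
  unfold sampleLaw
  infer_instance

theorem sampleLaw_eq_withDensity [SigmaFinite μ] {f : X → ℝ} (hf : Measurable f) :
    sampleLaw μ f n =
      (Measure.pi fun _ => μ).withDensity fun s => ∏ i, ENNReal.ofReal (f (s i)) :=
  pi_withDensity fun _ => hf.ennreal_ofReal

theorem rpow_mul_sampleLaw_le_hellingerRisk [SFinite μ] {f : X → ℝ} (hf : Measurable f)
    (hq : 0 ≤ q) {T : (Fin n → X) → X → ℝ} (hT : Measurable (Function.uncurry T)) (δ : ℝ≥0∞) :
    δ ^ q * sampleLaw μ f n {s | δ ≤ hellinger μ (T s) f} ≤ hellingerRisk μ q T f :=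
  calc δ ^ q * sampleLaw μ f n {s | δ ≤ hellinger μ (T s) f}
      ≤ δ ^ q * sampleLaw μ f n {s | δ ^ q ≤ hellinger μ (T s) f ^ q} := by
        gcongr δ ^ q * sampleLaw μ f n ?_
        exact fun s (hs : δ ≤ _) => ENNReal.rpow_le_rpow hs hq
    _ ≤ hellingerRisk μ q T f :=
        mul_meas_ge_le_lintegral ((measurable_hellinger_left hT hf).pow_const q) _

theorem exists_mul_rpow_le_hellingerRisk [IsProbabilityMeasure μ] {ι : Type*} [Fintype ι]
    [Nonempty ι] {f : ι → X → ℝ} (hf : ∀ j, Measurable (f j))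
    (hone : ∀ j, ∫⁻ x, ENNReal.ofReal (f j x) ∂μ = 1) {δ p : ℝ≥0∞}
    (hsep : Pairwise fun i j => 2 * δ ≤ hellinger μ (f i) (f j))
    (hp : ∀ j, (∫⁻ x, ENNReal.ofReal (f j x) ^ 2 ∂μ) ^ n ≤ p ^ 2 * Fintype.card ι)
    (hq : 0 ≤ q) {T : (Fin n → X) → X → ℝ} (hT : Measurable (Function.uncurry T)) :
    ∃ j, (1 - p) * δ ^ q ≤ hellingerRisk μ q T (f j) := by
  set B : ι → Set (Fin n → X) := fun j => {s | hellinger μ (T s) (f j) < δ}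
  have hB (j : ι) : MeasurableSet (B j) :=
    measurableSet_lt (measurable_hellinger_left hT (hf j)) measurable_const
  have hdisj : Pairwise fun i j => Disjoint (B i) (B j) := fun i j hij =>
    Set.disjoint_left.2 fun s (hi : _ < δ) (hj : _ < δ) => (hsep hij).not_gt <|
      calc hellinger μ (f i) (f j)
          ≤ hellinger μ (f i) (T s) + hellinger μ (T s) (f j) :=
            hellinger_triangle (hf i) hT.of_uncurry_left (hf j)
        _ < δ + δ := ENNReal.add_lt_add (hellinger_comm.trans_lt hi) hj
        _ = 2 * δ := (two_mul δ).symm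
  have hmoment (j : ι) : ∫⁻ s, (∏ i : Fin n, ENNReal.ofReal (f j (s i))) ^ 2
      ∂Measure.pi (fun _ => μ) ≤ p ^ 2 * Fintype.card ι := by
    simp_rw [← Finset.prod_pow]
    rw [lintegral_fin_nat_prod_eq_prod fun _ => (hf j).ennreal_ofReal.pow_const 2,
      Finset.prod_const, Finset.card_fin]
    exact hp j
  have hL (j : ι) : Measurable fun s : Fin n → X => ∏ i, ENNReal.ofReal (f j (s i)) :=
    Finset.measurable_fun_prod _ fun i _ => ((hf j).comp (measurable_pi_apply i)).ennreal_ofReal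
  obtain ⟨j, hj⟩ := exists_withDensity_le_of_lintegral_sq_le hL hB hdisj hmoment
  rw [← sampleLaw_eq_withDensity (hf j)] at hj
  have := isProbabilityMeasure_sampleLaw (n := n) (hone j)
  refine ⟨j, ?_⟩
  calc (1 - p) * δ ^ q
      ≤ sampleLaw μ (f j) n (B j)ᶜ * δ ^ q := by
        rw [prob_compl_eq_one_sub (hB j)]
        gcongr
    _ = δ ^ q * sampleLaw μ (f j) n {s | δ ≤ hellinger μ (T s) (f j)} := by
        have hcompl : (B j)ᶜ = {s | δ ≤ hellinger μ (T s) (f j)} := by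
          ext s
          simp [B]
        rw [mul_comm, hcompl]
    _ ≤ hellingerRisk μ q T (f j) := rpow_mul_sampleLaw_le_hellingerRisk (hf j) hq hT δ

end MinimaxRisk

section Localization

theorem ofReal_indicator_apply {X : Type*} {C : Set X} {f : X → ℝ} :
    (fun x => ENNReal.ofReal (C.indicator f x)) = C.indicator fun x => ENNReal.ofReal (f x) :=
  (Set.indicator_comp_of_zero ENNReal.ofReal_zero).symm

variable {X : Type*} [MeasurableSpace X] {ν : Measure X} {C : Set X} {f : X → ℝ}

theorem indicator_mem_boundedDensities {A : ℝ} (hC : MeasurableSet C)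
    (hf : f ∈ boundedDensities (ν.restrict C) A) : C.indicator f ∈ boundedDensities ν A := by
  obtain ⟨⟨hmeas, hnonneg, hle⟩, hone⟩ := hf
  refine ⟨⟨hmeas.indicator hC, Set.indicator_nonneg fun x _ => hnonneg x, fun x => ?_⟩, ?_⟩
  · exact (Set.indicator_le_self' (fun x _ => hnonneg x) x).trans (hle x)
  · rw [ofReal_indicator_apply, lintegral_indicator hC, hone]

theorem sampleLaw_indicator (hC : MeasurableSet C) (n : ℕ) :
    sampleLaw ν (C.indicator f) n = sampleLaw (ν.restrict C) f n := by
  rw [sampleLaw, ofReal_indicator_apply, withDensity_indicator hC, sampleLaw]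

theorem hellinger_restrict_le (hC : MeasurableSet C) (g : X → ℝ) :
    hellinger (ν.restrict C) g f ≤ hellinger ν g (C.indicator f) :=
  calc hellinger (ν.restrict C) g f
      = hellinger (ν.restrict C) g (C.indicator f) := by
        refine eLpNorm_congr_ae ((ae_restrict_iff' hC).2 (.of_forall fun x hx => ?_))
        simp only [Set.indicator_of_mem hx]
    _ ≤ hellinger ν g (C.indicator f) := eLpNorm_restrict_le _ _ _ _

theorem hellingerRisk_restrict_le {q : ℝ} (hq : 0 ≤ q) {n : ℕ} (hC : MeasurableSet C)
    (T : (Fin n → X) → X → ℝ) :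
    hellingerRisk (ν.restrict C) q T f ≤ hellingerRisk ν q T (C.indicator f) := by
  rw [hellingerRisk, hellingerRisk, sampleLaw_indicator hC]
  exact lintegral_mono fun s => ENNReal.rpow_le_rpow (hellinger_restrict_le hC (T s)) hq

end Localization

section ExcessRisk

variable {X : Type*} [MeasurableSpace X] {ν : Measure X} {q A : ℝ} {M n : ℕ}

theorem excessHellingerRisk_apply_self (hq : 0 < q) (g : Fin M → X → ℝ)
    (T : (Fin n → X) → X → ℝ) (j : Fin M) :
    excessHellingerRisk ν q g T (g j) = hellingerRisk ν q T (g j) := by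
  have hmin : ⨅ i, hellinger ν (g i) (g j) ^ q = 0 :=
    le_antisymm (iInf_le_of_le j (by rw [hellinger_self, ENNReal.zero_rpow_of_pos hq])) zero_le
  rw [excessHellingerRisk, hmin, EReal.coe_ennreal_zero, sub_zero]

theorem le_iSup_iInf_iSup_excessHellingerRisk (hq : 0 < q) {g : Fin M → X → ℝ}
    (hg : ∀ j, g j ∈ boundedDensities ν A) {b : ℝ≥0∞}
    (hb : ∀ T ∈ estimators X n, ∃ j, b ≤ hellingerRisk ν q T (g j)) :
    (b : EReal) ≤ ⨆ g : Fin M → boundedNonneg X A, ⨅ T : estimators X n,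
      ⨆ f : boundedDensities ν A,
        excessHellingerRisk ν q (fun j => (g j : X → ℝ)) (T : (Fin n → X) → X → ℝ) (f : X → ℝ) := by
  refine le_iSup_of_le (fun j => ⟨g j, (hg j).1⟩) (le_iInf fun T => ?_)
  obtain ⟨j, hj⟩ := hb T T.2
  refine le_iSup_of_le ⟨g j, hg j⟩ ?_
  rw [excessHellingerRisk_apply_self hq g]
  exact EReal.coe_ennreal_le_coe_ennreal_iff.2 hj

end ExcessRisk

section CosineIntegrals

open Real

theorem integral_cos_two_pi_int_mul {k : ℤ} (hk : k ≠ 0) :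
    ∫ t in (0 : ℝ)..1, cos (2 * π * k * t) = 0 := by
  have hfreq : 2 * π * k ≠ 0 := mul_ne_zero two_pi_pos.ne' (Int.cast_ne_zero.2 hk)
  have hperiod : sin (2 * π * k) = 0 := by
    rw [← sin_int_mul_pi (2 * k)]
    push_cast
    ring_nf
  rw [intervalIntegral.integral_comp_mul_left _ hfreq, integral_cos, mul_one, hperiod]
  simp

theorem integral_cos_mul_cos_eq_half {k l : ℕ} :
    ∫ t in (0 : ℝ)..1, cos (2 * π * k * t) * cos (2 * π * l * t) =
      ((∫ t in (0 : ℝ)..1, cos (2 * π * (k + l : ℤ) * t)) +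
        ∫ t in (0 : ℝ)..1, cos (2 * π * (k - l : ℤ) * t)) / 2 := by
  rw [← intervalIntegral.integral_add (Continuous.intervalIntegrable (by fun_prop) _ _)
    (Continuous.intervalIntegrable (by fun_prop) _ _), ← intervalIntegral.integral_div]
  refine intervalIntegral.integral_congr fun t _ => ?_
  have hadd : 2 * π * (k + l : ℤ) * t = 2 * π * k * t + 2 * π * l * t := by push_cast; ring
  have hsub : 2 * π * (k - l : ℤ) * t = 2 * π * k * t - 2 * π * l * t := by push_cast; ring
  simp only [hadd, hsub, cos_add, cos_sub]
  ring

theorem integral_cos_mul_cos {k l : ℕ} (hkl : k ≠ l) :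
    ∫ t in (0 : ℝ)..1, cos (2 * π * k * t) * cos (2 * π * l * t) = 0 := by
  rw [integral_cos_mul_cos_eq_half, integral_cos_two_pi_int_mul (by omega),
    integral_cos_two_pi_int_mul (by omega)]
  simp

theorem integral_cos_sq_two_pi_nat_mul {k : ℕ} (hk : k ≠ 0) :
    ∫ t in (0 : ℝ)..1, cos (2 * π * k * t) ^ 2 = 1 / 2 := by
  simp_rw [pow_two]
  rw [integral_cos_mul_cos_eq_half, integral_cos_two_pi_int_mul (by omega)]
  simp

theorem integral_one_add_mul_cos {k : ℕ} (hk : k ≠ 0) (ε : ℝ) :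
    ∫ t in (0 : ℝ)..1, (1 + ε * cos (2 * π * k * t)) = 1 := by
  have hmean := integral_cos_two_pi_int_mul (Int.natCast_ne_zero.2 hk)
  rw [intervalIntegral.integral_add (by simp)
    (Continuous.intervalIntegrable (by fun_prop) _ _), intervalIntegral.integral_const_mul]
  simp_all

theorem integral_one_add_mul_cos_sq {k : ℕ} (hk : k ≠ 0) (ε : ℝ) :
    ∫ t in (0 : ℝ)..1, (1 + ε * cos (2 * π * k * t)) ^ 2 = 1 + ε ^ 2 / 2 := by
  have hexpand (t : ℝ) : (1 + ε * cos (2 * π * k * t)) ^ 2 =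
      1 + 2 * ε * cos (2 * π * k * t) + ε ^ 2 * cos (2 * π * k * t) ^ 2 := by ring
  simp_rw [hexpand]
  rw [intervalIntegral.integral_add (Continuous.intervalIntegrable (by fun_prop) _ _)
    (Continuous.intervalIntegrable (by fun_prop) _ _), integral_one_add_mul_cos hk,
    intervalIntegral.integral_const_mul, integral_cos_sq_two_pi_nat_mul hk]
  ring

theorem integral_cos_sub_cos_sq {k l : ℕ} (hk : k ≠ 0) (hl : l ≠ 0) (hkl : k ≠ l) :
    ∫ t in (0 : ℝ)..1, (cos (2 * π * k * t) - cos (2 * π * l * t)) ^ 2 = 1 := by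
  have hexpand (t : ℝ) : (cos (2 * π * k * t) - cos (2 * π * l * t)) ^ 2 =
      cos (2 * π * k * t) ^ 2 - 2 * (cos (2 * π * k * t) * cos (2 * π * l * t)) +
        cos (2 * π * l * t) ^ 2 := by ring
  simp_rw [hexpand]
  rw [intervalIntegral.integral_add (Continuous.intervalIntegrable (by fun_prop) _ _)
      (Continuous.intervalIntegrable (by fun_prop) _ _),
    intervalIntegral.integral_sub (Continuous.intervalIntegrable (by fun_prop) _ _)
      (Continuous.intervalIntegrable (by fun_prop) _ _), intervalIntegral.integral_const_mul,
    integral_cos_sq_two_pi_nat_mul hk, integral_cos_sq_two_pi_nat_mul hl, integral_cos_mul_cos hkl]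
  norm_num

end CosineIntegrals

section CosineDensity

open Real

variable {X : Type*} [MeasurableSpace X] {μ : Measure X} {φ : X → ℝ} {ε : ℝ} {k l : ℕ}

/-- The perturbation of the uniform density by a cosine of frequency `k` and amplitude `ε`: the
hypotheses among which the lower bound discriminates. The point `x` enters only through a
coordinate `φ x`, meant to be uniformly distributed on `(0, 1]` under the reference measure. -/
noncomputable def cosineDensity (φ : X → ℝ) (ε : ℝ) (k : ℕ) (x : X) : ℝ :=
  1 + ε * cos (2 * π * k * φ x)

theorem lintegral_ofReal_comp (hφ : MeasurePreserving φ μ (volume.restrict (Set.Ioc 0 1)))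
    {G : ℝ → ℝ} (hG : Continuous G) (hnonneg : ∀ t, 0 ≤ G t) :
    ∫⁻ x, ENNReal.ofReal (G (φ x)) ∂μ = ENNReal.ofReal (∫ t in (0 : ℝ)..1, G t) := by
  rw [hφ.lintegral_comp (f := fun t => ENNReal.ofReal (G t)) (by fun_prop),
    intervalIntegral.integral_of_le zero_le_one,
    ofReal_integral_eq_lintegral_ofReal hG.integrableOn_Ioc (.of_forall hnonneg)]

theorem abs_mul_cos_le (hε0 : 0 ≤ ε) (t : ℝ) : |ε * cos t| ≤ ε := by
  rw [abs_mul, abs_of_nonneg hε0]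
  exact mul_le_of_le_one_right hε0 (abs_cos_le_one t)

theorem one_add_mul_cos_nonneg (hε0 : 0 ≤ ε) (hε1 : ε ≤ 1) (t : ℝ) : 0 ≤ 1 + ε * cos t := by
  linarith [(abs_le.1 (abs_mul_cos_le hε0 t)).1]

theorem cosineDensity_mem_boundedDensities
    (hφ : MeasurePreserving φ μ (volume.restrict (Set.Ioc 0 1))) (hε0 : 0 ≤ ε) (hε1 : ε ≤ 1)
    (hk : k ≠ 0) {A : ℝ} (hA : 1 + ε ≤ A) : cosineDensity φ ε k ∈ boundedDensities μ A := by
  have hmeas := hφ.measurable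
  refine ⟨⟨by unfold cosineDensity; fun_prop, fun x => one_add_mul_cos_nonneg hε0 hε1 _,
    fun x => ?_⟩, ?_⟩
  · exact hA.trans' (add_le_add_right (abs_le.1 (abs_mul_cos_le hε0 _)).2 1)
  · simp only [cosineDensity]
    rw [lintegral_ofReal_comp hφ (G := fun t => 1 + ε * cos (2 * π * k * t)) (by fun_prop)
      fun t => one_add_mul_cos_nonneg hε0 hε1 _, integral_one_add_mul_cos hk, ENNReal.ofReal_one]

theorem lintegral_ofReal_cosineDensity_sq
    (hφ : MeasurePreserving φ μ (volume.restrict (Set.Ioc 0 1))) (hε0 : 0 ≤ ε) (hε1 : ε ≤ 1)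
    (hk : k ≠ 0) :
    ∫⁻ x, ENNReal.ofReal (cosineDensity φ ε k x) ^ 2 ∂μ = ENNReal.ofReal (1 + ε ^ 2 / 2) := by
  simp only [cosineDensity, ← ENNReal.ofReal_pow (one_add_mul_cos_nonneg hε0 hε1 _)]
  rw [lintegral_ofReal_comp hφ (G := fun t => (1 + ε * cos (2 * π * k * t)) ^ 2) (by fun_prop)
    fun t => sq_nonneg _, integral_one_add_mul_cos_sq hk]

theorem eLpNorm_two_sq_eq_lintegral_ofReal {f : X → ℝ} :
    eLpNorm f 2 μ ^ 2 = ∫⁻ x, ENNReal.ofReal (f x ^ 2) ∂μ := by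
  have h := eLpNorm_nnreal_pow_eq_lintegral (μ := μ) (f := f) (p := 2) two_ne_zero
  simp only [ENNReal.coe_ofNat, NNReal.coe_ofNat, ENNReal.rpow_ofNat] at h
  simp_rw [h, ← Real.enorm_of_nonneg (sq_nonneg _), enorm_pow]

theorem eLpNorm_cosineDensity_sub
    (hφ : MeasurePreserving φ μ (volume.restrict (Set.Ioc 0 1))) (hε0 : 0 ≤ ε)
    (hk : k ≠ 0) (hl : l ≠ 0) (hkl : k ≠ l) :
    eLpNorm (fun x => cosineDensity φ ε k x - cosineDensity φ ε l x) 2 μ = ENNReal.ofReal ε := by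
  refine (ENNReal.pow_right_strictMono two_ne_zero).injective ?_
  have hfactor (x : X) : (cosineDensity φ ε k x - cosineDensity φ ε l x) ^ 2 =
      ε ^ 2 * (cos (2 * π * k * φ x) - cos (2 * π * l * φ x)) ^ 2 := by
    simp only [cosineDensity]
    ring
  simp only [eLpNorm_two_sq_eq_lintegral_ofReal, hfactor]
  rw [lintegral_ofReal_comp hφ
      (G := fun t => ε ^ 2 * (cos (2 * π * k * t) - cos (2 * π * l * t)) ^ 2) (by fun_prop)
      fun t => by positivity, intervalIntegral.integral_const_mul,
    integral_cos_sub_cos_sq hk hl hkl, mul_one, ENNReal.ofReal_pow hε0]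

theorem le_hellinger_cosineDensity
    (hφ : MeasurePreserving φ μ (volume.restrict (Set.Ioc 0 1))) (hε0 : 0 ≤ ε) (hε1 : ε ≤ 1)
    (hk : k ≠ 0) (hl : l ≠ 0) (hkl : k ≠ l) :
    ENNReal.ofReal (ε / 4) ≤ hellinger μ (cosineDensity φ ε k) (cosineDensity φ ε l) := by
  -- The densities are bounded by `2`; the cruder bound `4` has a rational square root.
  have hbound {m : ℕ} (hm : m ≠ 0) : cosineDensity φ ε m ∈ boundedNonneg X 4 :=
    (cosineDensity_mem_boundedDensities hφ hε0 hε1 hm (by linarith)).1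
  have h := eLpNorm_sub_le_mul_hellinger (μ := μ) (hbound hk) (hbound hl)
  rw [eLpNorm_cosineDensity_sub hφ hε0 hk hl hkl] at h
  have h_four : 2 * √4 = (4 : ℝ) := by
    rw [show (4 : ℝ) = 2 ^ 2 by norm_num, sqrt_sq zero_le_two]
    norm_num
  rw [ENNReal.ofReal_div_of_pos four_pos]
  exact ENNReal.div_le_of_le_mul' (h_four ▸ h)

theorem rpow_sqrt_div {r c : ℝ} (hr : 0 ≤ r) (hc : 0 ≤ c) (q : ℝ) :
    (√r / c) ^ q = (1 / c) ^ q * r ^ (q / 2) := by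
  rw [div_eq_mul_one_div, mul_rpow (sqrt_nonneg r) (by positivity), sqrt_eq_rpow,
    ← rpow_mul hr, one_div_mul_eq_div, mul_comm]

theorem one_add_half_sq_pow_le {M n : ℕ} (hM : 2 ≤ M) (h : n * ε ^ 2 ≤ log M / 16) :
    (1 + ε ^ 2 / 2) ^ n ≤ (3 / 4) ^ 2 * M := by
  have hM' : (2 : ℝ) ≤ M := by exact_mod_cast hM
  calc (1 + ε ^ 2 / 2) ^ n ≤ exp (ε ^ 2 / 2) ^ n := by
        gcongr
        linarith [add_one_le_exp (ε ^ 2 / 2)]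
    _ = exp (n * (ε ^ 2 / 2)) := (exp_nat_mul _ _).symm
    _ ≤ exp (log M * (1 / 32)) := exp_le_exp.2 (by linarith)
    _ = (1 + (M - 1 : ℝ)) ^ (1 / 32 : ℝ) := by
        rw [add_sub_cancel, rpow_def_of_pos (by linarith)]
    _ ≤ 1 + 1 / 32 * (M - 1) :=
        rpow_one_add_le_one_add_mul_self (by linarith) (by norm_num) (by norm_num)
    _ ≤ (3 / 4) ^ 2 * M := by linarith

theorem exists_le_hellingerRisk_cosineDensity
    (hφ : MeasurePreserving φ μ (volume.restrict (Set.Ioc 0 1))) (hε0 : 0 ≤ ε) (hε1 : ε ≤ 1)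
    {M n : ℕ} (hM : 2 ≤ M) (hεn : n * ε ^ 2 ≤ log M / 16) {q : ℝ} (hq : 0 ≤ q)
    {T : (Fin n → X) → X → ℝ} (hT : Measurable (Function.uncurry T)) :
    ∃ j : Fin M, ENNReal.ofReal ((ε / 8) ^ q / 4) ≤
      hellingerRisk μ q T (cosineDensity φ ε (j + 1)) := by
  have : IsProbabilityMeasure μ :=
    ⟨by simpa using hφ.measure_preimage (s := .univ) .univ⟩
  have : NeZero M := ⟨by omega⟩
  have hmem (j : Fin M) : cosineDensity φ ε (j + 1) ∈ boundedDensities μ 2 :=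
    cosineDensity_mem_boundedDensities hφ hε0 hε1 (Nat.succ_ne_zero j) (by linarith)
  have hsep : Pairwise fun i j : Fin M => 2 * ENNReal.ofReal (ε / 8) ≤
      hellinger μ (cosineDensity φ ε (i + 1)) (cosineDensity φ ε (j + 1)) := fun i j hij => by
    have hne : (i + 1 : ℕ) ≠ j + 1 := by simpa [Fin.val_inj] using hij
    refine le_of_eq_of_le ?_ (le_hellinger_cosineDensity hφ hε0 hε1 (Nat.succ_ne_zero i)
      (Nat.succ_ne_zero j) hne)
    rw [two_mul, ← ENNReal.ofReal_add (by positivity) (by positivity)]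
    ring_nf
  have hmoment (j : Fin M) :
      (∫⁻ x, ENNReal.ofReal (cosineDensity φ ε (j + 1) x) ^ 2 ∂μ) ^ n ≤
        ENNReal.ofReal (3 / 4) ^ 2 * Fintype.card (Fin M) := by
    rw [lintegral_ofReal_cosineDensity_sq hφ hε0 hε1 (Nat.succ_ne_zero j),
      ← ENNReal.ofReal_pow (by positivity), ← ENNReal.ofReal_pow (by positivity),
      Fintype.card_fin, ← ENNReal.ofReal_natCast, ← ENNReal.ofReal_mul (by positivity)]
    exact ENNReal.ofReal_le_ofReal (one_add_half_sq_pow_le hM hεn)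
  obtain ⟨j, hj⟩ := exists_mul_rpow_le_hellingerRisk (fun j => (hmem j).1.1)
    (fun j => (hmem j).2) hsep hmoment hq hT
  refine ⟨j, le_of_eq_of_le ?_ hj⟩
  rw [ENNReal.ofReal_rpow_of_nonneg (by positivity) hq, ← ENNReal.ofReal_one,
    ← ENNReal.ofReal_sub _ (by norm_num), ← ENNReal.ofReal_mul (by norm_num)]
  ring_nf

end CosineDensity

theorem measurePreserving_eval_restrict_unitCube {ι : Type*} [Fintype ι] (i : ι) :
    MeasurePreserving (Function.eval i)
      ((volume : Measure (ι → ℝ)).restrict (Set.univ.pi fun _ => Set.Ioc 0 1))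
      (volume.restrict (Set.Ioc 0 1)) := by
  have : IsProbabilityMeasure (volume.restrict (Set.Ioc (0 : ℝ) 1)) := ⟨by simp⟩
  rw [volume_pi, Measure.restrict_pi_pi]
  exact measurePreserving_eval (fun _ : ι => volume.restrict (Set.Ioc (0 : ℝ) 1)) i

end Aggregation

open Aggregation in
theorem mainTheorem2_general {X : Type*} [MeasurableSpace X] {ν : Measure X} {C : Set X}
    (hC : MeasurableSet C) {φ : X → ℝ}
    (hφ : MeasurePreserving φ (ν.restrict C) (volume.restrict (Set.Ioc 0 1))) {A : ℝ} (hA : 1 < A)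
    {q : ℝ} (hq : 0 < q) {M : ℕ} (hM : 2 ≤ M) {n : ℕ}
    (hn : Real.log M ≤ 16 * (min 1 (A - 1)) ^ 2 * n) :
    (((1 / 32) ^ q / 4 * (Real.log M / n) ^ (q / 2) : ℝ) : EReal) ≤
      ⨆ g : Fin M → boundedNonneg X A, ⨅ T : estimators X n, ⨆ f : boundedDensities ν A,
        excessHellingerRisk ν q (fun j => (g j : X → ℝ)) (T : (Fin n → X) → X → ℝ) (f : X → ℝ) := by
  have hmin : 0 < min 1 (A - 1) := lt_min one_pos (by linarith)
  have hlog : 0 < Real.log M := Real.log_pos (by exact_mod_cast hM)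
  have hn0 : 0 < (n : ℝ) := pos_of_mul_pos_right (hlog.trans_le hn) (by positivity)
  set ε : ℝ := √(Real.log M / n) / 4 with hε
  have hε0 : 0 ≤ ε := by positivity
  have hεsq : n * ε ^ 2 = Real.log M / 16 := by
    rw [hε, div_pow, Real.sq_sqrt (by positivity)]
    field_simp
    norm_num
  have hεmin : ε ≤ min 1 (A - 1) := by
    refine le_of_sq_le_sq (le_of_mul_le_mul_left ?_ hn0) hmin.le
    linarith
  obtain ⟨hε1, hεA⟩ := le_min_iff.1 hεmin
  have hrate : (1 / 32 : ℝ) ^ q / 4 * (Real.log M / n) ^ (q / 2) = (ε / 8) ^ q / 4 := by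
    rw [div_mul_eq_mul_div, ← rpow_sqrt_div (by positivity) (by norm_num), hε, div_div]
    norm_num
  rw [hrate, ← max_eq_left (show 0 ≤ (ε / 8) ^ q / 4 by positivity), ← EReal.coe_ennreal_ofReal]
  refine le_iSup_iInf_iSup_excessHellingerRisk hq
    (fun j : Fin M => indicator_mem_boundedDensities hC (cosineDensity_mem_boundedDensities hφ
      hε0 hε1 (Nat.succ_ne_zero j) (by linarith))) fun T hT => ?_
  obtain ⟨j, hj⟩ := exists_le_hellingerRisk_cosineDensity hφ hε0 hε1 hM hεsq.le hq.le hT.1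
  exact ⟨j, hj.trans (hellingerRisk_restrict_le hq.le hC T)⟩

theorem mainTheorem2 (A : ℝ) (hA : 1 < A) (q : ℝ) (hq : 0 < q) :
    ∃ c : ℝ, 0 < c ∧ ∀ d : ℕ, 1 ≤ d → ∀ M : ℕ, 2 ≤ M → ∀ n : ℕ,
      Real.log M ≤ 16 * (min 1 (A - 1)) ^ 2 * n →
      ((c * (Real.log M / n) ^ (q / 2) : ℝ) : EReal) ≤
        ⨆ g : Fin M → Aggregation.boundedNonneg (Fin d → ℝ) A,
          ⨅ T : Aggregation.estimators (Fin d → ℝ) n,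
            ⨆ f : Aggregation.boundedDensities (volume : Measure (Fin d → ℝ)) A,
              Aggregation.excessHellingerRisk (volume : Measure (Fin d → ℝ)) q
                (fun j => (g j : (Fin d → ℝ) → ℝ)) (T : (Fin n → Fin d → ℝ) → (Fin d → ℝ) → ℝ)
                (f : (Fin d → ℝ) → ℝ) := by
  exact ⟨(1 / 32) ^ q / 4, by positivity, fun d hd M hM n hn =>
    mainTheorem2_general (.univ_pi fun _ => measurableSet_Ioc)
      (Aggregation.measurePreserving_eval_restrict_unitCube ⟨0, hd⟩) hA hq hM hn⟩
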